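/- Let $\mathcal A=(Q,\Sigma,\Gamma,\delta,Q_0,F)$ be a one-way (non-deterministic) Büchi transducer: $Q,\Sigma,\Gamma$ are finite sets, $Q_0,F\subseteq Q$ are the sets of initial and accepting states, and $\delta\subseteq Q\times\Sigma\times Q\times\Gamma^*$ is a finite transition relation. A run on an $\omega$-word is final if it visits some state of $F$ infinitely often, and accepting if it is final and starts in $Q_0$. Assume that every final run produces an infinite output, that $\mathcal A$ is trim (every state appears in some accepting run), and that $\mathcal A$ is functional, i.e. the relation $\{(x,y)\in\Sigma^\omega\times\Gamma^\omega : y \text{ is the output of an accepting run on } x\}$ is a partial function $f$. For $x,y\in\Sigma^\omega$ (or in $\Gamma^\omega$) let $|x\wedge y|\in\mathbb N\cup\{\infty\}$ be the length of their longest common prefix. The function $f$ is continuous if for all $x\in\mathrm{dom}(f)$ and all $i\ge 0$ there is $j\ge 0$ such that for all $y\in\mathrm{dom}(f)$, $|x\wedge y|\ge j$ implies $|f(x)\wedge f(y)|\ge i$; it is uniformly continuous if for all $i\ge 0$ there is $j\ge 0$ such that for all $x,y\in\mathrm{dom}(f)$, $|x\wedge y|\ge j$ implies $|f(x)\wedge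 f(y)|\ge i$. Write $p\xrightarrow{u|v}q$ if there is a finite run from $p$ to $q$ on input $u\in\Sigma^*$ with output $v\in\Gamma^*$, and say that $\mathrm{mismatch}(u,v)$ holds if there is a position $i\le |u|,|v|$ with $u[i]\ne v[i]$. Then: (1) $f$ is not continuous if and only if $\mathcal A$ satisfies $\phi_{\text{cont}}$: there are states $p_1,q_1,p_2,q_2,r_2$, input words $u,v,w\in\Sigma^*$ with $v\neq\epsilon$, and output words $u_1,v_1,u_2,v_2,w_2\in\Gamma^*$ such that $$p_1\xrightarrow{u|u_1}q_1\xrightarrow{v|v_1}q_1,\qquad p_2\xrightarrow{u|u_2}q_2\xrightarrow{v|v_2}q_2\xrightarrow{w|w_2}r_2,$$ $p_1,p_2\in Q_0$, $q_1\in F$, and $$\mathrm{mismatch}(u_1,u_2)\ \vee\ \big(v_2=\epsilon\wedge\mathrm{mismatch}(u_1,u_2w_2)\big).$$ (2) $f$ is not uniformly continuous if and only if $\mathcal A$ satisfies $\phi_{\text{u-cont}}$: there are states $p_1,q_1,r_1,p_2,q_2,r_2$, input words $u,v,w,w'\in\Sigma^*$ with $v\neq\epsilon$, and output words $u_1,v_1,w_1,u_2,v_2,w_2\in\Gamma^*$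 such that $$p_1\xrightarrow{u|u_1}q_1\xrightarrow{v|v_1}q_1\xrightarrow{w|w_1}r_1,\qquad p_2\xrightarrow{u|u_2}q_2\xrightarrow{v|v_2}q_2\xrightarrow{w'|w_2}r_2,$$ $p_1,p_2\in Q_0$, and $$\mathrm{mismatch}(u_1,u_2)\ \vee\ \big(v_1=\epsilon\wedge\mathrm{mismatch}(u_1w_1,u_2)\big)\ \vee\ \big(v_2=\epsilon\wedge\mathrm{mismatch}(u_1,u_2w_2)\big)\ \vee\ \big(v_1=v_2=\epsilon\wedge\mathrm{mismatch}(u_1w_1,u_2w_2)\big).$$ -/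

import Mathlib

/-- A one-way Büchi transducer with state set `Q`, input alphabet `A` and output alphabet `B`
(all three are assumed finite where transducers are used). A transition `(p, a, q, γ)` goes from
`p` to `q`, reads the letter `a` and produces the finite word `γ`. -/
structure BuchiTransducer (Q A B : Type*) where
  trans : Set (Q × A × Q × List B)
  trans_finite : trans.Finite
  init : Set Q
  acc : Set Q

/-- An infinite sequence of states together with the outputs of the successive transitions. -/
structure InfRun (Q B : Type*) where
  state : ℕ → Q
  out : ℕ → List B

namespace InfRun

variable {Q B : Type*}

/-- The concatenation of the outputs of the first `n` transitions. -/
def outPrefix (ρ : InfRun Q B) (n : ℕ) : List B :=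
  ((List.range n).map ρ.out).flatten

/-- The output of the run (the concatenation of all its outputs) is infinite. -/
def InfiniteOutput (ρ : InfRun Q B) : Prop :=
  ∀ k : ℕ, ∃ n : ℕ, k ≤ (ρ.outPrefix n).length

/-- The output of the run is the infinite word `y`. -/
def HasOutput (ρ : InfRun Q B) (y : ℕ → B) : Prop :=
  ρ.InfiniteOutput ∧
    ∀ (n k : ℕ) (hk : k < (ρ.outPrefix n).length), (ρ.outPrefix n)[k] = y k

end InfRun

/-- The infinite words `x` and `y` have a common prefix of length `n`, i.e. `|x ∧ y| ≥ n`. -/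
def AgreeTo {A : Type*} (n : ℕ) (x y : ℕ → A) : Prop :=
  ∀ k < n, x k = y k

/-- Continuity at a point `x` of the domain of a partial function on infinite words. -/
def OmegaContinuousAt {A B : Type*} (f : (ℕ → A) →. (ℕ → B)) (x : ℕ → A) : Prop :=
  ∀ fx ∈ f x, ∀ i : ℕ, ∃ j : ℕ, ∀ y, ∀ fy ∈ f y, AgreeTo j x y → AgreeTo i fx fy

/-- Continuity of a partial function on infinite words: continuity at each point of its domain. -/
def OmegaContinuous {A B : Type*} (f : (ℕ → A) →. (ℕ → B)) : Prop :=
  ∀ x ∈ f.Dom, OmegaContinuousAt f x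

/-- Uniform continuity of a partial function on infinite words. -/
def OmegaUniformlyContinuous {A B : Type*} (f : (ℕ → A) →. (ℕ → B)) : Prop :=
  ∀ i : ℕ, ∃ j : ℕ, ∀ x y, ∀ fx ∈ f x, ∀ fy ∈ f y, AgreeTo j x y → AgreeTo i fx fy

/-- Two finite words differ at some position that exists in both. -/
def Mismatch {B : Type*} (u v : List B) : Prop :=
  ∃ (i : ℕ) (hu : i < u.length) (hv : i < v.length), u[i] ≠ v[i]

namespace BuchiTransducer

variable {Q A B : Type*}

/-- `ρ` is a run on the infinite word `x`, from an arbitrary state. -/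
def IsRun (T : BuchiTransducer Q A B) (x : ℕ → A) (ρ : InfRun Q B) : Prop :=
  ∀ i : ℕ, (ρ.state i, x i, ρ.state (i + 1), ρ.out i) ∈ T.trans

/-- `ρ` is a final run on `x`: some accepting state is visited infinitely often. -/
def IsFinalRun (T : BuchiTransducer Q A B) (x : ℕ → A) (ρ : InfRun Q B) : Prop :=
  T.IsRun x ρ ∧ ∃ q ∈ T.acc, ∃ᶠ i in Filter.atTop, ρ.state i = q

/-- `ρ` is an accepting run on `x`: a final run from an initial state. -/
def IsAcceptingRun (T : BuchiTransducer Q A B) (x : ℕ → A) (ρ : InfRun Q B) : Prop :=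
  T.IsFinalRun x ρ ∧ ρ.state 0 ∈ T.init

/-- Every final run produces an infinite word. -/
def FinalRunsProduceInfinite (T : BuchiTransducer Q A B) : Prop :=
  ∀ x ρ, T.IsFinalRun x ρ → ρ.InfiniteOutput

/-- Every state appears in some accepting run. -/
def Trim (T : BuchiTransducer Q A B) : Prop :=
  ∀ q : Q, ∃ x ρ, T.IsAcceptingRun x ρ ∧ ∃ i : ℕ, ρ.state i = q

/-- The relation on infinite words computed by the transducer. -/
def Rel (T : BuchiTransducer Q A B) (x : ℕ → A) (y : ℕ → B) : Prop :=
  ∃ ρ, T.IsAcceptingRun x ρ ∧ ρ.HasOutput y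

/-- The relation computed by the transducer is a (partial) function. -/
def Functional (T : BuchiTransducer Q A B) : Prop :=
  ∀ x y y', T.Rel x y → T.Rel x y' → y = y'

/-- The partial function defined by a functional transducer. -/
noncomputable def toFun (T : BuchiTransducer Q A B) : (ℕ → A) →. (ℕ → B) :=
  fun x => ⟨∃ y, T.Rel x y, fun h => Classical.choose h⟩

theorem mem_toFun_iff (T : BuchiTransducer Q A B) (hT : T.Functional) (x : ℕ → A) (y : ℕ → B) :
    y ∈ T.toFun x ↔ T.Rel x y := by
  constructor
  · rintro ⟨h, rfl⟩
    exact Classical.choose_spec h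
  · intro h
    exact ⟨⟨y, h⟩, hT _ _ _ (Classical.choose_spec (⟨y, h⟩ : ∃ y, T.Rel x y)) h⟩

/-- `T.FinRun p u v q`: there is a finite run from `p` to `q` on the input `u` with output `v`. -/
inductive FinRun (T : BuchiTransducer Q A B) : Q → List A → List B → Q → Prop
  | nil (q : Q) : FinRun T q [] [] q
  | cons {p q r : Q} {a : A} {γ : List B} {u : List A} {v : List B}
      (h : (p, a, q, γ) ∈ T.trans) (t : FinRun T q u v r) : FinRun T p (a :: u) (γ ++ v) r

/-- The pattern for non-continuity. The common loop is over a nonempty input word `v`. -/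
def PatternCont (T : BuchiTransducer Q A B) : Prop :=
  ∃ (p₁ q₁ p₂ q₂ r₂ : Q) (u v w : List A) (u₁ v₁ u₂ v₂ w₂ : List B),
    T.FinRun p₁ u u₁ q₁ ∧ T.FinRun q₁ v v₁ q₁ ∧
    T.FinRun p₂ u u₂ q₂ ∧ T.FinRun q₂ v v₂ q₂ ∧ T.FinRun q₂ w w₂ r₂ ∧
    v ≠ [] ∧
    (p₁ ∈ T.init ∧ p₂ ∈ T.init ∧ q₁ ∈ T.acc) ∧
    (Mismatch u₁ u₂ ∨ (v₂ = [] ∧ Mismatch u₁ (u₂ ++ w₂)))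

/-- The pattern for non-uniform-continuity. The common loop is over a nonempty input word `v`. -/
def PatternUCont (T : BuchiTransducer Q A B) : Prop :=
  ∃ (p₁ q₁ r₁ p₂ q₂ r₂ : Q) (u v w w' : List A) (u₁ v₁ w₁ u₂ v₂ w₂ : List B),
    T.FinRun p₁ u u₁ q₁ ∧ T.FinRun q₁ v v₁ q₁ ∧ T.FinRun q₁ w w₁ r₁ ∧
    T.FinRun p₂ u u₂ q₂ ∧ T.FinRun q₂ v v₂ q₂ ∧ T.FinRun q₂ w' w₂ r₂ ∧
    v ≠ [] ∧
    (p₁ ∈ T.init ∧ p₂ ∈ T.init) ∧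
    (Mismatch u₁ u₂ ∨
      (v₁ = [] ∧ Mismatch (u₁ ++ w₁) u₂) ∨
      (v₂ = [] ∧ Mismatch u₁ (u₂ ++ w₂)) ∨
      (v₁ = [] ∧ v₂ = [] ∧ Mismatch (u₁ ++ w₁) (u₂ ++ w₂)))

end BuchiTransducer

/-! By the pigeonhole principle on the state and the output length truncated at `i`, two long runs
on inputs with a long common prefix visit a pair of states twice at common positions `m < m'`. The
loop between `m` and `m'` is then either silent or entered with at least `i` letters of output. In
both cases a word of length at least `i` is output by runs that share any prescribed number of
iterations of the loop with the given run. Hence a disagreement below `i` that persists under ever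
longer common prefixes of the inputs is a mismatch between two such words, and pumping the loops
gives the converse. For continuity at a single point `x`, the positions are chosen among the visits
of an accepting state by the run on `x`, so that the loop can be repeated forever. -/

/-- Infinite words over `A`. Mathlib's `Stream'` is not reducibly equal to the type `ℕ → A` of the
words read and written by a transducer, so its operations are not available for them. -/
abbrev OmegaWord (A : Type*) := ℕ → A

/-- The finite word `u` is a prefix of the infinite word `x`. -/
def StartsWith {A : Type*} (u : List A) (x : OmegaWord A) : Prop :=
  ∀ (k : ℕ) (hk : k < u.length), u[k] = x k

section FiniteWords

variable {A : Type*} {u v : List A} {x y : OmegaWord A} {n : ℕ}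

theorem StartsWith.of_append (h : StartsWith (u ++ v) x) : StartsWith u x := fun k hk =>
  (List.getElem_append_left hk).symm.trans
    (h k (hk.trans_le (by simp only [List.length_append, Nat.le_add_right])))

theorem Mismatch.not_agreeTo (h : Mismatch u v) (hx : StartsWith u x) (hy : StartsWith v y) :
    ¬ AgreeTo u.length x y := by
  obtain ⟨i, hu, hv, hne⟩ := h
  exact fun hxy => hne ((hx i hu).trans ((hxy i hu).trans (hy i hv).symm))

theorem mismatch_of_not_agreeTo (h : ¬ AgreeTo n x y) (hx : StartsWith u x) (hy : StartsWith v y)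
    (hu : n ≤ u.length) (hv : n ≤ v.length) : Mismatch u v := by
  simp only [AgreeTo, not_forall] at h
  obtain ⟨k, hk, hne⟩ := h
  exact ⟨k, hk.trans_le hu, hk.trans_le hv, by rwa [hx, hy]⟩

theorem AgreeTo.mono {m : ℕ} (h : AgreeTo n x y) (hmn : m ≤ n) : AgreeTo m x y :=
  fun k hk => h k (hk.trans_le hmn)

theorem le_length_append_flatten_replicate (u : List A) (hv : v ≠ []) (n : ℕ) :
    n ≤ (u ++ (List.replicate n v).flatten).length := by
  simp only [List.length_append, List.length_flatten, List.map_replicate, List.sum_replicate_nat]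
  exact Nat.le_add_left_of_le (Nat.le_mul_of_pos_right n (List.length_pos_of_ne_nil hv))

end FiniteWords

namespace OmegaWord

variable {A : Type*} {u v : List A} {x y : OmegaWord A}

/-- The prefix of length `n`. -/
def take (n : ℕ) (x : OmegaWord A) : List A := (List.range n).map x

/-- The suffix that starts at position `m`. -/
def drop (m : ℕ) (x : OmegaWord A) : OmegaWord A := fun k => x (m + k)

/-- The infinite word with first letter `a`, followed by `x`. -/
def cons (a : A) (x : OmegaWord A) : OmegaWord A
  | 0 => a
  | k + 1 => x k

/-- The concatenation of a finite and an infinite word. -/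
def append (u : List A) (x : OmegaWord A) : OmegaWord A := u.foldr cons x

theorem take_add (m l : ℕ) (x : OmegaWord A) :
    take (m + l) x = take m x ++ take l (drop m x) := by
  simp only [take, List.range_add, List.map_append, List.map_map]
  rfl

theorem take_succ (n : ℕ) (x : OmegaWord A) : take (n + 1) x = take n x ++ [x n] := by
  simp only [take, List.range_succ, List.map_append, List.map_singleton]

theorem take_succ_cons (n : ℕ) (a : A) (x : OmegaWord A) :
    take (n + 1) (cons a x) = a :: take n x := by
  simp only [take, List.range_succ_eq_map, List.map_cons, List.map_map]
  rfl

theorem take_ne_nil {n : ℕ} (hn : n ≠ 0) (x : OmegaWord A) : take n x ≠ [] := by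
  simpa only [take, ne_eq, List.map_eq_nil_iff, List.range_eq_nil] using hn

theorem take_eq_take {n : ℕ} (h : AgreeTo n x y) : take n x = take n y :=
  List.map_congr_left fun k hk => h k (List.mem_range.1 hk)

theorem take_drop_eq_take_drop {m l : ℕ} (h : AgreeTo (m + l) x y) :
    take l (drop m x) = take l (drop m y) :=
  take_eq_take fun k hk => h (m + k) (Nat.add_lt_add_left hk m)

theorem append_append (u v : List A) (x : OmegaWord A) :
    append (u ++ v) x = append u (append v x) :=
  List.foldr_append

theorem append_apply_of_lt {k : ℕ} (hk : k < u.length) (x : OmegaWord A) :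
    append u x k = u[k] := by
  induction u generalizing k with
  | nil => exact absurd hk k.not_lt_zero
  | cons a u ih =>
    cases k with
    | zero => rfl
    | succ k => exact ih (Nat.lt_of_succ_lt_succ hk)

theorem append_apply_length_add (u : List A) (x : OmegaWord A) (k : ℕ) :
    append u x (u.length + k) = x k := by
  induction u with
  | nil => exact congrArg x (Nat.zero_add k)
  | cons a u ih =>
    rw [List.length_cons, Nat.add_right_comm]
    exact ih

theorem agreeTo_append {n : ℕ} (hn : n ≤ u.length) (x y : OmegaWord A) :
    AgreeTo n (append u x) (append u y) := fun k hk => by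
  rw [append_apply_of_lt (hk.trans_le hn), append_apply_of_lt (hk.trans_le hn)]

theorem append_flatten_replicate (h : append u x = x) (n : ℕ) :
    append (List.replicate n u).flatten x = x := by
  induction n with
  | zero => rfl
  | succ n ih => rw [List.replicate_succ, List.flatten_cons, append_append, ih, h]

/-- The infinite repetition of a nonempty finite word. -/
def cycle (u : List A) (hu : u ≠ []) : OmegaWord A :=
  fun n => u[n % u.length]'(Nat.mod_lt n (List.length_pos_of_ne_nil hu))

theorem append_cycle (hu : u ≠ []) : append u (cycle u hu) = cycle u hu := by
  funext k
  rcases lt_or_ge k u.length with hk | hk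
  · rw [append_apply_of_lt hk]
    simp only [cycle, Nat.mod_eq_of_lt hk]
  · obtain ⟨j, rfl⟩ := Nat.exists_eq_add_of_le hk
    rw [append_apply_length_add]
    simp only [cycle, Nat.add_mod_left]

end OmegaWord

theorem frequently_atTop_add_iff {P : ℕ → Prop} (m : ℕ) :
    (∃ᶠ n in Filter.atTop, P (n + m)) ↔ ∃ᶠ n in Filter.atTop, P n := by
  rw [← Filter.frequently_map (m := (· + m)) (P := P), Filter.map_add_atTop_eq_nat]

theorem map_succ_mod_eq {α : Type*} {f : ℕ → α} {l : ℕ} (hl : 0 < l) (hf : f l = f 0) (n : ℕ) :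
    f ((n + 1) % l) = f (n % l + 1) := by
  have hle : n % l + 1 ≤ l := Nat.mod_lt n hl
  rcases hle.lt_or_eq with hlt | heq
  · rw [← Nat.mod_add_mod, Nat.mod_eq_of_lt hlt]
  · rw [← Nat.mod_add_mod, heq, Nat.mod_self, hf]

theorem exists_lt_le_card_map_eq {α : Type*} [Finite α] (f : ℕ → α) :
    ∃ a b, a < b ∧ b ≤ Nat.card α ∧ f a = f b := by
  have := Fintype.ofFinite α
  obtain ⟨a, b, hab, hf⟩ := Fintype.exists_ne_map_eq_of_card_lt
    (fun k : Fin (Nat.card α + 1) => f k) (by simp)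
  rcases lt_or_gt_of_ne hab with h | h
  · exact ⟨a, b, h, Nat.le_of_lt_succ b.2, hf⟩
  · exact ⟨b, a, h, Nat.le_of_lt_succ a.2, hf.symm⟩

namespace InfRun

variable {Q B : Type*}

/-- The run `ρ` without its first `m` transitions. -/
def drop (m : ℕ) (ρ : InfRun Q B) : InfRun Q B where
  state := OmegaWord.drop m ρ.state
  out := OmegaWord.drop m ρ.out

/-- The run `ρ` preceded by a transition from `p` with output `γ`. -/
def cons (p : Q) (γ : List B) (ρ : InfRun Q B) : InfRun Q B where
  state := OmegaWord.cons p ρ.state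
  out := OmegaWord.cons γ ρ.out

/-- The state reached by `ρ` after `n` transitions together with the length of the output produced
so far. The length is truncated at `i`, so that finitely many states give finitely many values. -/
def truncatedConfig (ρ : InfRun Q B) (i n : ℕ) : Q × Fin (i + 1) :=
  (ρ.state n, ⟨min i (ρ.outPrefix n).length, Nat.lt_succ_of_le (min_le_left _ _)⟩)

theorem outPrefix_eq_flatten_take (ρ : InfRun Q B) (n : ℕ) :
    ρ.outPrefix n = (OmegaWord.take n ρ.out).flatten :=
  rfl

theorem outPrefix_add (ρ : InfRun Q B) (m l : ℕ) :
    ρ.outPrefix (m + l) = ρ.outPrefix m ++ (ρ.drop m).outPrefix l := by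
  simp only [outPrefix_eq_flatten_take, OmegaWord.take_add, List.flatten_append, drop]

theorem outPrefix_succ (ρ : InfRun Q B) (n : ℕ) :
    ρ.outPrefix (n + 1) = ρ.outPrefix n ++ ρ.out n := by
  simp only [outPrefix_eq_flatten_take, OmegaWord.take_succ, List.flatten_append,
    List.flatten_singleton]

theorem outPrefix_cons_succ (p : Q) (γ : List B) (ρ : InfRun Q B) (n : ℕ) :
    (ρ.cons p γ).outPrefix (n + 1) = γ ++ ρ.outPrefix n := by
  simp only [outPrefix_eq_flatten_take, cons, OmegaWord.take_succ_cons, List.flatten_cons]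

theorem outPrefix_isPrefix (ρ : InfRun Q B) {m n : ℕ} (h : m ≤ n) :
    ρ.outPrefix m <+: ρ.outPrefix n := by
  obtain ⟨l, rfl⟩ := Nat.exists_eq_add_of_le h
  exact ⟨_, (ρ.outPrefix_add m l).symm⟩

theorem HasOutput.startsWith {ρ : InfRun Q B} {y : OmegaWord B} (h : ρ.HasOutput y) (n : ℕ) :
    StartsWith (ρ.outPrefix n) y :=
  h.2 n

theorem InfiniteOutput.exists_hasOutput {ρ : InfRun Q B} (h : ρ.InfiniteOutput) :
    ∃ y, ρ.HasOutput y := by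
  choose n hn using fun k => h (k + 1)
  refine ⟨fun k => (ρ.outPrefix (n k))[k]'(hn k), h, fun m k hk => ?_⟩
  rcases le_total m (n k) with hm | hm
  · exact (ρ.outPrefix_isPrefix hm).getElem hk
  · exact ((ρ.outPrefix_isPrefix hm).getElem (hn k)).symm

theorem InfiniteOutput.exists_le_length_append {ρ : InfRun Q B} (h : ρ.InfiniteOutput) (m k : ℕ) :
    ∃ l, k ≤ (ρ.outPrefix m ++ (ρ.drop m).outPrefix l).length := by
  obtain ⟨n, hn⟩ := h k
  refine ⟨n, hn.trans ?_⟩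
  rw [← outPrefix_add]
  exact (ρ.outPrefix_isPrefix (Nat.le_add_left n m)).length_le

theorem le_length_or_outPrefix_drop_eq_nil {ρ : InfRun Q B} {i m l : ℕ}
    (h : ρ.truncatedConfig i m = ρ.truncatedConfig i (m + l)) :
    i ≤ (ρ.outPrefix m).length ∨ (ρ.drop m).outPrefix l = [] := by
  have hlen : min i (ρ.outPrefix m).length = min i (ρ.outPrefix (m + l)).length :=
    congrArg (fun c => (c.2 : ℕ)) h
  rw [outPrefix_add, List.length_append] at hlen
  rw [← List.length_eq_zero_iff]
  lia

end InfRun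

namespace BuchiTransducer

variable {Q A B : Type*} {T : BuchiTransducer Q A B}

theorem rel_of_mem_toFun {x : OmegaWord A} {y : OmegaWord B} (h : y ∈ T.toFun x) : T.Rel x y := by
  obtain ⟨hx, rfl⟩ := h
  exact Classical.choose_spec hx

theorem FinRun.append {p q r : Q} {u u' : List A} {v v' : List B}
    (h : T.FinRun p u v q) (h' : T.FinRun q u' v' r) : T.FinRun p (u ++ u') (v ++ v') r := by
  induction h with
  | nil => exact h'
  | cons hpq _ ih => rw [List.cons_append, List.append_assoc]; exact .cons hpq (ih h')

section InfiniteRuns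

variable {x : OmegaWord A} {ρ : InfRun Q B}

theorem IsRun.drop (h : T.IsRun x ρ) (m : ℕ) : T.IsRun (OmegaWord.drop m x) (ρ.drop m) :=
  fun i => h (m + i)

theorem IsFinalRun.drop (h : T.IsFinalRun x ρ) (m : ℕ) :
    T.IsFinalRun (OmegaWord.drop m x) (ρ.drop m) := by
  obtain ⟨hrun, q, hq, hfreq⟩ := h
  refine ⟨hrun.drop m, q, hq, ?_⟩
  simpa only [Nat.add_comm] using! (frequently_atTop_add_iff m).2 hfreq

theorem IsFinalRun.cons {p : Q} {a : A} {γ : List B} (hp : (p, a, ρ.state 0, γ) ∈ T.trans)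
    (h : T.IsFinalRun x ρ) : T.IsFinalRun (OmegaWord.cons a x) (ρ.cons p γ) := by
  obtain ⟨hrun, q, hq, hfreq⟩ := h
  refine ⟨?_, q, hq, (frequently_atTop_add_iff 1).1 hfreq⟩
  rintro (_ | i)
  · exact hp
  · exact hrun i

theorem Trim.exists_isFinalRun (hT : T.Trim) (q : Q) :
    ∃ x ρ, T.IsFinalRun x ρ ∧ ρ.state 0 = q := by
  obtain ⟨x, ρ, ⟨hρ, -⟩, m, rfl⟩ := hT q
  exact ⟨_, _, hρ.drop m, rfl⟩

theorem Trim.finite (hT : T.Trim) : Finite Q := by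
  refine Set.finite_univ_iff.1 ((T.trans_finite.image Prod.fst).subset fun q _ => ?_)
  obtain ⟨x, ρ, hρ, rfl⟩ := hT.exists_isFinalRun q
  exact ⟨_, hρ.1 0, rfl⟩

theorem IsRun.finRun_take (h : T.IsRun x ρ) (n : ℕ) :
    T.FinRun (ρ.state 0) (OmegaWord.take n x) (ρ.outPrefix n) (ρ.state n) := by
  induction n with
  | zero => exact .nil _
  | succ n ih =>
    rw [OmegaWord.take_succ, InfRun.outPrefix_succ]
    simpa only [List.append_nil] using ih.append (.cons (h n) (.nil _))

theorem IsRun.finRun_take_drop (h : T.IsRun x ρ) (m l : ℕ) :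
    T.FinRun (ρ.state m) (OmegaWord.take l (OmegaWord.drop m x)) ((ρ.drop m).outPrefix l)
      (ρ.state (m + l)) :=
  (h.drop m).finRun_take l

end InfiniteRuns

section FiniteRuns

variable {p q : Q} {u : List A} {v : List B}

theorem FinRun.flatten_replicate (h : T.FinRun q u v q) (n : ℕ) :
    T.FinRun q (List.replicate n u).flatten (List.replicate n v).flatten q := by
  induction n with
  | zero => exact .nil q
  | succ n ih => simpa only [List.replicate_succ, List.flatten_cons] using h.append ih

theorem FinRun.exists_isFinalRun (h : T.FinRun p u v q) {z : OmegaWord A} {ρ : InfRun Q B}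
    (hρ : T.IsFinalRun z ρ) (hq : ρ.state 0 = q) :
    ∃ ρ', T.IsFinalRun (OmegaWord.append u z) ρ' ∧ ρ'.state 0 = p ∧ ρ'.outPrefix u.length = v := by
  induction h with
  | nil => exact ⟨ρ, hρ, hq, rfl⟩
  | cons hpq _ ih =>
    obtain ⟨ρ', hρ', rfl, rfl⟩ := ih hq
    exact ⟨_, hρ'.cons hpq, rfl, InfRun.outPrefix_cons_succ _ _ _ _⟩

theorem FinRun.exists_rel (h : T.FinRun p u v q) (hinf : T.FinalRunsProduceInfinite)
    (hp : p ∈ T.init) {z : OmegaWord A} {ρ : InfRun Q B} (hρ : T.IsFinalRun z ρ)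
    (hq : ρ.state 0 = q) : ∃ y, T.Rel (OmegaWord.append u z) y ∧ StartsWith v y := by
  obtain ⟨ρ', hρ', rfl, rfl⟩ := h.exists_isFinalRun hρ hq
  obtain ⟨y, hy⟩ := (hinf _ ρ' hρ').exists_hasOutput
  exact ⟨y, ⟨ρ', ⟨hρ', hp⟩, hy⟩, hy.startsWith _⟩

theorem FinRun.exists_rel_of_trim (h : T.FinRun p u v q) (htrim : T.Trim)
    (hinf : T.FinalRunsProduceInfinite) (hp : p ∈ T.init) :
    ∃ z y, T.Rel (OmegaWord.append u z) y ∧ StartsWith v y := by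
  obtain ⟨z, ρ, hρ, hq⟩ := htrim.exists_isFinalRun q
  exact ⟨z, h.exists_rel hinf hp hρ hq⟩

theorem FinRun.exists_infRun (h : T.FinRun p u v q) :
    ∃ ρ : InfRun Q B, ρ.state 0 = p ∧ ρ.state u.length = q ∧
      ∀ (i : ℕ) (hi : i < u.length), (ρ.state i, u[i], ρ.state (i + 1), ρ.out i) ∈ T.trans := by
  induction h with
  | nil q => exact ⟨⟨fun _ => q, fun _ => []⟩, rfl, rfl, fun i hi => absurd hi i.not_lt_zero⟩
  | @cons p _ _ _ γ _ _ hpq _ ih =>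
    obtain ⟨ρ, rfl, hq, hstep⟩ := ih
    refine ⟨ρ.cons p γ, rfl, hq, ?_⟩
    rintro (_ | i) hi
    · exact hpq
    · exact hstep i (Nat.lt_of_succ_lt_succ hi)

theorem FinRun.exists_isFinalRun_of_loop (h : T.FinRun q u v q) (hu : u ≠ []) (hq : q ∈ T.acc) :
    ∃ z ρ, T.IsFinalRun z ρ ∧ ρ.state 0 = q ∧ OmegaWord.append u z = z := by
  obtain ⟨ρ, rfl, hloop, hstep⟩ := h.exists_infRun
  have hlen : 0 < u.length := List.length_pos_of_ne_nil hu
  refine ⟨OmegaWord.cycle u hu, ⟨fun n => ρ.state (n % u.length), fun n => ρ.out (n % u.length)⟩,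
    ⟨fun n => ?_, _, hq, Filter.frequently_atTop.2 fun n => ?_⟩, ?_, OmegaWord.append_cycle hu⟩
  · simpa only [OmegaWord.cycle, map_succ_mod_eq hlen hloop] using hstep _ (Nat.mod_lt n hlen)
  · exact ⟨n * u.length, Nat.le_mul_of_pos_right n hlen, by simp only [Nat.mul_mod_left]⟩
  · simp only [Nat.zero_mod]

end FiniteRuns

/-- The word `o` is produced, for every `n`, by some finite run from an initial state on an input
that starts with `u vⁿ`: the run reaches a state with a loop on `v`, and either `o` is the output
on `u`, or the loop is silent and `o` is the output on `u` followed by that of any continuation. It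
gathers the disjuncts of the two patterns: those of `PatternUCont` are the mismatches between two
lasso outputs for the same `u` and `v`. -/
inductive LassoOutput (T : BuchiTransducer Q A B) (u v : List A) : List B → Prop
  | beforeLoop {p q : Q} {o v' : List B} (hp : p ∈ T.init) (hu : T.FinRun p u o q)
      (hv : T.FinRun q v v' q) : LassoOutput T u v o
  | afterSilentLoop {p q r : Q} {w : List A} {o w' : List B} (hp : p ∈ T.init)
      (hu : T.FinRun p u o q) (hv : T.FinRun q v [] q) (hw : T.FinRun q w w' r) :
      LassoOutput T u v (o ++ w')

/-- The word `o` is produced on `u` by a finite run from an initial state to an accepting state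
that has a loop on `v`. -/
def AcceptingLassoOutput (T : BuchiTransducer Q A B) (u v : List A) (o : List B) : Prop :=
  ∃ p ∈ T.init, ∃ q ∈ T.acc, ∃ v', T.FinRun p u o q ∧ T.FinRun q v v' q

section Lassos

variable {u v : List A} {o o₁ o₂ : List B} {x : OmegaWord A} {y : OmegaWord B} {ρ : InfRun Q B}

theorem patternCont_iff_exists_lassoOutput : T.PatternCont ↔ ∃ u v o₁ o₂, v ≠ [] ∧
    T.AcceptingLassoOutput u v o₁ ∧ T.LassoOutput u v o₂ ∧ Mismatch o₁ o₂ := by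
  constructor
  · rintro ⟨p₁, q₁, p₂, q₂, r₂, u, v, w, u₁, v₁, u₂, v₂, w₂, hu₁, hv₁, hu₂, hv₂, hw₂, hv,
      ⟨hp₁, hp₂, hq₁⟩, hmis⟩
    have hlasso : T.AcceptingLassoOutput u v u₁ := ⟨p₁, hp₁, q₁, hq₁, v₁, hu₁, hv₁⟩
    rcases hmis with hmis | ⟨rfl, hmis⟩
    · exact ⟨u, v, _, _, hv, hlasso, .beforeLoop hp₂ hu₂ hv₂, hmis⟩
    · exact ⟨u, v, _, _, hv, hlasso, .afterSilentLoop hp₂ hu₂ hv₂ hw₂, hmis⟩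
  · rintro ⟨u, v, o₁, o₂, hv, ⟨p₁, hp₁, q₁, hq₁, v₁, hu₁, hv₁⟩,
      ⟨hp₂, hu₂, hv₂⟩ | ⟨hp₂, hu₂, hv₂, hw₂⟩, hmis⟩
    · exact ⟨_, _, _, _, _, _, _, _, _, _, _, _, _, hu₁, hv₁, hu₂, hv₂, .nil _, hv,
        ⟨hp₁, hp₂, hq₁⟩, .inl hmis⟩
    · exact ⟨_, _, _, _, _, _, _, _, _, _, _, _, _, hu₁, hv₁, hu₂, hv₂, hw₂, hv,
        ⟨hp₁, hp₂, hq₁⟩, .inr ⟨rfl, hmis⟩⟩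

theorem patternUCont_iff_exists_lassoOutput : T.PatternUCont ↔ ∃ u v o₁ o₂, v ≠ [] ∧
    T.LassoOutput u v o₁ ∧ T.LassoOutput u v o₂ ∧ Mismatch o₁ o₂ := by
  constructor
  · rintro ⟨p₁, q₁, r₁, p₂, q₂, r₂, u, v, w, w', u₁, v₁, w₁, u₂, v₂, w₂, hu₁, hv₁, hw₁,
      hu₂, hv₂, hw₂, hv, ⟨hp₁, hp₂⟩, hmis | ⟨rfl, hmis⟩ | ⟨rfl, hmis⟩ | ⟨rfl, rfl, hmis⟩⟩
    · exact ⟨u, v, _, _, hv, .beforeLoop hp₁ hu₁ hv₁, .beforeLoop hp₂ hu₂ hv₂, hmis⟩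
    · exact ⟨u, v, _, _, hv, .afterSilentLoop hp₁ hu₁ hv₁ hw₁, .beforeLoop hp₂ hu₂ hv₂, hmis⟩
    · exact ⟨u, v, _, _, hv, .beforeLoop hp₁ hu₁ hv₁, .afterSilentLoop hp₂ hu₂ hv₂ hw₂, hmis⟩
    · exact ⟨u, v, _, _, hv, .afterSilentLoop hp₁ hu₁ hv₁ hw₁,
        .afterSilentLoop hp₂ hu₂ hv₂ hw₂, hmis⟩
  · rintro ⟨u, v, o₁, o₂, hv, ⟨hp₁, hu₁, hv₁⟩ | ⟨hp₁, hu₁, hv₁, hw₁⟩,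
      ⟨hp₂, hu₂, hv₂⟩ | ⟨hp₂, hu₂, hv₂, hw₂⟩, hmis⟩
    · exact ⟨_, _, _, _, _, _, _, _, _, _, _, _, _, _, _, _, hu₁, hv₁, .nil _, hu₂, hv₂, .nil _,
        hv, ⟨hp₁, hp₂⟩, .inl hmis⟩
    · exact ⟨_, _, _, _, _, _, _, _, _, _, _, _, _, _, _, _, hu₁, hv₁, .nil _, hu₂, hv₂, hw₂,
        hv, ⟨hp₁, hp₂⟩, .inr (.inr (.inl ⟨rfl, hmis⟩))⟩
    · exact ⟨_, _, _, _, _, _, _, _, _, _, _, _, _, _, _, _, hu₁, hv₁, hw₁, hu₂, hv₂, .nil _,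
        hv, ⟨hp₁, hp₂⟩, .inr (.inl ⟨rfl, hmis⟩)⟩
    · exact ⟨_, _, _, _, _, _, _, _, _, _, _, _, _, _, _, _, hu₁, hv₁, hw₁, hu₂, hv₂, hw₂,
        hv, ⟨hp₁, hp₂⟩, .inr (.inr (.inr ⟨rfl, rfl, hmis⟩))⟩

theorem LassoOutput.exists_rel (h : T.LassoOutput u v o) (htrim : T.Trim)
    (hinf : T.FinalRunsProduceInfinite) (n : ℕ) :
    ∃ z y, T.Rel (OmegaWord.append (u ++ (List.replicate n v).flatten) z) y ∧ StartsWith o y := by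
  cases h with
  | beforeLoop hp hu hv =>
    obtain ⟨z, y, hxy, hy⟩ :=
      (hu.append (hv.flatten_replicate n)).exists_rel_of_trim htrim hinf hp
    exact ⟨z, y, hxy, hy.of_append⟩
  | @afterSilentLoop p q r w o w' hp hu hv hw =>
    have hloops : T.FinRun q (List.replicate n v).flatten [] q := by
      simpa only [List.flatten_replicate_nil] using hv.flatten_replicate n
    obtain ⟨z, y, hxy, hy⟩ :=
      ((hu.append hloops).append hw).exists_rel_of_trim htrim hinf hp
    rw [List.append_nil] at hy
    rw [OmegaWord.append_append] at hxy
    exact ⟨OmegaWord.append w z, y, hxy, hy⟩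

theorem AcceptingLassoOutput.exists_rel (h : T.AcceptingLassoOutput u v o)
    (hinf : T.FinalRunsProduceInfinite) (hv : v ≠ []) :
    ∃ z y, T.Rel (OmegaWord.append u z) y ∧ OmegaWord.append v z = z ∧ StartsWith o y := by
  obtain ⟨p, hp, q, hq, v', hpq, hqq⟩ := h
  obtain ⟨z, ρ, hρ, hs, hz⟩ := hqq.exists_isFinalRun_of_loop hv hq
  obtain ⟨y, hxy, hy⟩ := hpq.exists_rel hinf hp hρ hs
  exact ⟨z, y, hxy, hz, hy⟩

theorem IsRun.acceptingLassoOutput (hρ : T.IsRun x ρ) (hinit : ρ.state 0 ∈ T.init) {m l : ℕ}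
    (hacc : ρ.state m ∈ T.acc) (hloop : ρ.state m = ρ.state (m + l)) :
    T.AcceptingLassoOutput (OmegaWord.take m x) (OmegaWord.take l (OmegaWord.drop m x))
      (ρ.outPrefix m) :=
  ⟨_, hinit, _, hacc, _, hρ.finRun_take m, by simpa only [← hloop] using hρ.finRun_take_drop m l⟩

theorem IsRun.exists_lassoOutput (hρ : T.IsRun x ρ) (hinit : ρ.state 0 ∈ T.init)
    (hy : ρ.HasOutput y) {i m l : ℕ}
    (hloop : ρ.truncatedConfig i m = ρ.truncatedConfig i (m + l)) :
    ∃ o, T.LassoOutput (OmegaWord.take m x) (OmegaWord.take l (OmegaWord.drop m x)) o ∧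
      i ≤ o.length ∧ StartsWith o y := by
  have hstate : ρ.state m = ρ.state (m + l) := congrArg Prod.fst hloop
  have hu := hρ.finRun_take m
  have hv := hρ.finRun_take_drop m l
  rw [← hstate] at hv
  rcases InfRun.le_length_or_outPrefix_drop_eq_nil hloop with hlong | hsilent
  · exact ⟨_, .beforeLoop hinit hu hv, hlong, hy.startsWith m⟩
  · rw [hsilent] at hv
    obtain ⟨k, hk⟩ := hy.1.exists_le_length_append m i
    exact ⟨_, .afterSilentLoop hinit hu hv (hρ.finRun_take_drop m k), hk,
      ρ.outPrefix_add m k ▸ hy.startsWith (m + k)⟩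

end Lassos

theorem PatternCont.not_omegaContinuous (h : T.PatternCont) (hfun : T.Functional) (htrim : T.Trim)
    (hinf : T.FinalRunsProduceInfinite) : ¬ OmegaContinuous T.toFun := by
  obtain ⟨u, v, o₁, o₂, hv, h₁, h₂, hmis⟩ := patternCont_iff_exists_lassoOutput.1 h
  obtain ⟨z, y, hxy, hz, hy⟩ := h₁.exists_rel hinf hv
  have hmem := (T.mem_toFun_iff hfun _ y).2 hxy
  intro hcont
  obtain ⟨n, hn⟩ := hcont _ (Part.dom_iff_mem.2 ⟨y, hmem⟩) y hmem o₁.length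
  obtain ⟨z', y', hxy', hy'⟩ := h₂.exists_rel htrim hinf n
  have hagree : AgreeTo n (OmegaWord.append u z)
        (OmegaWord.append (u ++ (List.replicate n v).flatten) z') := by
    rw [← OmegaWord.append_flatten_replicate hz n, ← OmegaWord.append_append]
    exact OmegaWord.agreeTo_append (le_length_append_flatten_replicate u hv n) _ _
  exact hmis.not_agreeTo hy hy' (hn _ y' ((T.mem_toFun_iff hfun _ y').2 hxy') hagree)

theorem PatternUCont.not_omegaUniformlyContinuous (h : T.PatternUCont) (hfun : T.Functional)
    (htrim : T.Trim) (hinf : T.FinalRunsProduceInfinite) :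
    ¬ OmegaUniformlyContinuous T.toFun := by
  obtain ⟨u, v, o₁, o₂, hv, h₁, h₂, hmis⟩ := patternUCont_iff_exists_lassoOutput.1 h
  intro hcont
  obtain ⟨n, hn⟩ := hcont o₁.length
  obtain ⟨z, y, hxy, hy⟩ := h₁.exists_rel htrim hinf n
  obtain ⟨z', y', hxy', hy'⟩ := h₂.exists_rel htrim hinf n
  exact hmis.not_agreeTo hy hy' (hn _ _ y ((T.mem_toFun_iff hfun _ y).2 hxy) y'
    ((T.mem_toFun_iff hfun _ y').2 hxy')
    (OmegaWord.agreeTo_append (le_length_append_flatten_replicate u hv n) _ _))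

theorem patternCont_of_not_omegaContinuous [Finite Q] (h : ¬ OmegaContinuous T.toFun) :
    T.PatternCont := by
  simp only [OmegaContinuous, OmegaContinuousAt, not_forall, not_exists] at h
  obtain ⟨x, -, y, hy, i, hi⟩ := h
  obtain ⟨ρ, ⟨⟨hρ, q, hq, hfreq⟩, hρinit⟩, hρy⟩ := rel_of_mem_toFun hy
  obtain ⟨n₀, hn₀⟩ := hρy.1 i
  obtain ⟨φ, hφ, hvisit⟩ := Filter.extraction_of_frequently_atTop
    (hfreq.and_eventually (Filter.eventually_ge_atTop n₀))
  obtain ⟨x', y', hy', hxx', hyy'⟩ := hi (φ (Nat.card (Q × Fin (i + 1))))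
  obtain ⟨σ, ⟨⟨hσ, -⟩, hσinit⟩, hσy'⟩ := rel_of_mem_toFun hy'
  obtain ⟨a, b, hab, hb, hloop⟩ := exists_lt_le_card_map_eq fun k => σ.truncatedConfig i (φ k)
  obtain ⟨l, hl⟩ := Nat.exists_eq_add_of_lt (hφ hab)
  rw [add_assoc] at hl
  rw [hl] at hloop
  have hagree : AgreeTo (φ a + (l + 1)) x x' := hxx'.mono (hl ▸ hφ.monotone hb)
  have hstate : ρ.state (φ a) = ρ.state (φ a + (l + 1)) :=
    hl ▸ (hvisit a).1.trans (hvisit b).1.symm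
  have hlong : i ≤ (ρ.outPrefix (φ a)).length :=
    hn₀.trans (ρ.outPrefix_isPrefix (hvisit a).2).length_le
  have hlasso := hρ.acceptingLassoOutput hρinit ((hvisit a).1 ▸ hq) hstate
  obtain ⟨o, hσlasso, ho, hoy'⟩ := hσ.exists_lassoOutput hσinit hσy' hloop
  rw [← OmegaWord.take_eq_take (hagree.mono (Nat.le_add_right _ _)),
    ← OmegaWord.take_drop_eq_take_drop hagree] at hσlasso
  exact patternCont_iff_exists_lassoOutput.2 ⟨_, _, _, o, OmegaWord.take_ne_nil l.succ_ne_zero _,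
    hlasso, hσlasso, mismatch_of_not_agreeTo hyy' (hρy.startsWith _) hoy' hlong ho⟩

theorem patternUCont_of_not_omegaUniformlyContinuous [Finite Q]
    (h : ¬ OmegaUniformlyContinuous T.toFun) : T.PatternUCont := by
  simp only [OmegaUniformlyContinuous, not_forall, not_exists] at h
  obtain ⟨i, hi⟩ := h
  obtain ⟨x, x', y, hy, y', hy', hxx', hyy'⟩ :=
    hi (Nat.card ((Q × Fin (i + 1)) × (Q × Fin (i + 1))))
  obtain ⟨ρ, ⟨⟨hρ, -⟩, hρinit⟩, hρy⟩ := rel_of_mem_toFun hy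
  obtain ⟨σ, ⟨⟨hσ, -⟩, hσinit⟩, hσy'⟩ := rel_of_mem_toFun hy'
  obtain ⟨m, m', hmm', hm', hloop⟩ :=
    exists_lt_le_card_map_eq fun k => (ρ.truncatedConfig i k, σ.truncatedConfig i k)
  obtain ⟨l, rfl⟩ := Nat.exists_eq_add_of_lt hmm'
  rw [add_assoc] at hm' hloop
  have hagree : AgreeTo (m + (l + 1)) x x' := hxx'.mono hm'
  obtain ⟨o, hρlasso, ho, hoy⟩ :=
    hρ.exists_lassoOutput hρinit hρy (congrArg Prod.fst hloop)
  obtain ⟨o', hσlasso, ho', hoy'⟩ :=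
    hσ.exists_lassoOutput hσinit hσy' (congrArg Prod.snd hloop)
  rw [← OmegaWord.take_eq_take (hagree.mono (Nat.le_add_right _ _)),
    ← OmegaWord.take_drop_eq_take_drop hagree] at hσlasso
  exact patternUCont_iff_exists_lassoOutput.2 ⟨_, _, o, o', OmegaWord.take_ne_nil l.succ_ne_zero _,
    hρlasso, hσlasso, mismatch_of_not_agreeTo hyy' hoy hoy' ho ho'⟩

end BuchiTransducer

theorem mainTheorem5_general {Q A B : Type*} (T : BuchiTransducer Q A B) (hfun : T.Functional)
    (htrim : T.Trim) (hinf : T.FinalRunsProduceInfinite) :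
    (¬ OmegaContinuous T.toFun ↔ T.PatternCont) ∧
      (¬ OmegaUniformlyContinuous T.toFun ↔ T.PatternUCont) := by
  have := htrim.finite
  exact ⟨⟨BuchiTransducer.patternCont_of_not_omegaContinuous,
      fun h => h.not_omegaContinuous hfun htrim hinf⟩,
    ⟨BuchiTransducer.patternUCont_of_not_omegaUniformlyContinuous,
      fun h => h.not_omegaUniformlyContinuous hfun htrim hinf⟩⟩

theorem mainTheorem5 {Q A B : Type*} [Finite Q] [Finite A] [Finite B]
    (T : BuchiTransducer Q A B) (hfun : T.Functional) (htrim : T.Trim)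
    (hinf : T.FinalRunsProduceInfinite) :
    (¬ OmegaContinuous T.toFun ↔ T.PatternCont) ∧
      (¬ OmegaUniformlyContinuous T.toFun ↔ T.PatternUCont) :=
  mainTheorem5_general T hfun htrim hinf
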